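/- Let $L\ge 2$ be an integer and let $P,N>0$ be real numbers with $\frac NP\le\frac{L-1}{L}$. For a list of $L$ distinct points $x_1,\dots,x_L\in\mathbb R^n$ with centroid $\bar x=\frac1L\sum_i x_i$ put $\overline{\mathrm{rad}}^2(x_1,\dots,x_L)=\frac1L\sum_{i=1}^L\|x_i-\bar x\|_2^2$. A set $\mathcal C\subseteq\{x\in\mathbb R^n:\|x\|_2\le\sqrt{nP}\}$ is called $(P,N,L-1)$-average-radius list-decodable if the minimum of $\overline{\mathrm{rad}}^2$ over all $L$-element subsets of $\mathcal C$ (which is $+\infty$ if there are none) exceeds $nN$. Its rate is $R(\mathcal C)=\frac1n\ln|\mathcal C|$, and the $(P,N,L-1)$-average-radius list-decoding capacity is $$\overline C_{L-1}(P,N)=\limsup_{n\to\infty}\ \sup\{R(\mathcal C):\mathcal C\subset\mathbb R^n\text{ is }(P,N,L-1)\text{-average-radius list-decodable}\}.$$ Let $$B=\frac12\left(1-\frac{LN}{(L-1)P}-\frac1{L-1}\ln\frac{L(P-N)}{P}\right).$$ **Theorem.** (1) $\overline C_{L-1}(P,N)\ge B$. (2) Every rate below $B$ is achieved by expurgated random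 spherical codes: for every real $R<B$, let $M=\lceil e^{nR}\rceil$, sample $M$ independent uniform points from the sphere of radius $\sqrt{nP}$ centred at the origin of $\mathbb R^n$, and let $\mathcal C$ be the set of these points. Then, with probability tending to $1$ as $n\to\infty$, every code $\mathcal C'$ obtained from $\mathcal C$ by removing one (arbitrarily chosen) point of each $L$-element subset of $\mathcal C$ with $\overline{\mathrm{rad}}^2\le nN$ is $(P,N,L-1)$-average-radius list-decodable and satisfies $|\mathcal C'|\ge M/2$ (hence has rate at least $R-\frac{\ln 2}{n}$). -/

import Mathlib

open MeasureTheory Filter Topology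
open scoped ENNReal

namespace MultiplePacking

/-- Euclidean space `ℝⁿ` with the `ℓ₂` norm. -/
abbrev Pt (n : ℕ) : Type := EuclideanSpace ℝ (Fin n)

/-- The centroid of a finite list of points. -/
noncomputable def centroid {n : ℕ} (S : Finset (Pt n)) : Pt n :=
  (S.card : ℝ)⁻¹ • ∑ x ∈ S, x

/-- The average squared radius of a list: the average squared distance to its centroid. -/
noncomputable def avgRadSq {n : ℕ} (S : Finset (Pt n)) : ℝ :=
  (S.card : ℝ)⁻¹ * ∑ x ∈ S, ‖x - centroid S‖ ^ 2

/-- The `L`-lists of a code, i.e. its subsets of size `L`. -/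
def lists {n : ℕ} (L : ℕ) (C : Set (Pt n)) : Set (Finset (Pt n)) :=
  {S | (S : Set (Pt n)) ⊆ C ∧ S.card = L}

/-- The `(L-1)`-average squared radius of a code: the minimum of the average squared radius over
its `L`-lists (it is `⊤` if there are none). -/
noncomputable def codeAvgRadSq {n : ℕ} (L : ℕ) (C : Set (Pt n)) : EReal :=
  ⨅ S ∈ lists L C, (avgRadSq S : EReal)

/-- `(P, N, L-1)`-average-radius list-decodable codes in `ℝⁿ`. -/
def IsAvgRadListDecodable {n : ℕ} (P N : ℝ) (L : ℕ) (C : Set (Pt n)) : Prop :=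
  C ⊆ Metric.closedBall 0 (Real.sqrt (n * P)) ∧ ((n * N : ℝ) : EReal) < codeAvgRadSq L C

/-- The rate `(1/n) ln |C|` of a code (`⊤` if `C` is infinite, `⊥` if it is empty, for `n ≥ 1`). -/
noncomputable def rate {n : ℕ} (C : Set (Pt n)) : EReal :=
  ENNReal.log (C.encard : ℝ≥0∞) / (n : EReal)

/-- The `(P, N, L-1)`-average-radius list-decoding capacity. -/
noncomputable def avgRadCapacity (P N : ℝ) (L : ℕ) : EReal :=
  limsup (fun n : ℕ => ⨆ C ∈ {C : Set (Pt n) | IsAvgRadListDecodable P N L C}, rate C) atTop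

/-- The uniform distribution on the unit sphere of `ℝⁿ`: normalized surface measure. -/
noncomputable def uniformSphere (n : ℕ) : Measure (Metric.sphere (0 : Pt n) 1) :=
  ((volume : Measure (Pt n)).toSphere Set.univ)⁻¹ • (volume : Measure (Pt n)).toSphere

/-- The law of `M` independent uniform points of the unit sphere of `ℝⁿ`. -/
noncomputable def sphereSample (n M : ℕ) : Measure (Fin M → Metric.sphere (0 : Pt n) 1) :=
  Measure.pi fun _ => uniformSphere n

/-- The spherical code `{√(nP) u₁, …, √(nP) u_M}` of power `P` given by unit vectors `u₁, …, u_M`. -/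
noncomputable def sphericalCode {n M : ℕ} (P : ℝ) (u : Fin M → Metric.sphere (0 : Pt n) 1) :
    Set (Pt n) :=
  Set.range fun i => Real.sqrt (n * P) • (u i : Pt n)

/-- The bad `L`-lists of a code: those whose average squared radius is at most `nN`. -/
def badLists {n : ℕ} (N : ℝ) (L : ℕ) (C : Set (Pt n)) : Set (Finset (Pt n)) :=
  {S ∈ lists L C | avgRadSq S ≤ n * N}

/-- `C'` is an expurgation of `C`: one point of each bad `L`-list of `C` has been removed. -/
def IsExpurgation {n : ℕ} (N : ℝ) (L : ℕ) (C C' : Set (Pt n)) : Prop :=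
  ∃ c : Finset (Pt n) → Pt n, (∀ S ∈ badLists N L C, c S ∈ S) ∧ C' = C \ (c '' badLists N L C)

end MultiplePacking

namespace MultiplePacking

/-! On the sphere of radius `√(nP)` the average squared radius of an `L`-list is `nP` minus the
squared norm of the centroid, so a list is bad exactly when the sum of its unit vectors has squared
norm at least `L * t`, where `t = L(P-N)/P`. For independent uniform vectors this has probability
about `exp(-(n/2)(t - 1 - log t))`, and `(t - 1 - log t)/2 = (L-1)B`. There are at most
`M(M-1)^(L-1)` lists, so when `R < B` the expected number of bad ones is exponentially small
compared with `M`. Markov's inequality then leaves at least half the points after expurgation.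

The tail bound compares the sphere with a Gaussian. A Gaussian vector is `r u` with `r` and `u`
independent; Jensen in `r` bounds the exponential moment of `u` by a Gaussian one
(`lintegral_exp_inner_uniformSphere_le`). This bound multiplies over independent points, and
integrating it against a Gaussian in the dual variable gives an exponential moment of the squared
norm of the sum (`lintegral_exp_norm_sum_sq_le`), to which Chernoff's method applies. -/

/-- Jensen's inequality for the exponential, as a statement on lower integrals. -/
lemma measure_univ_mul_exp_le_lintegral_exp {α : Type*} [MeasurableSpace α] (ν : Measure α)
    [IsFiniteMeasure ν] {X : α → ℝ} (hXm : Measurable X) (hX : Integrable X ν) {m : ℝ}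
    (hm : ∫ x, X x ∂ν = m * ν.real Set.univ) (a : ℝ) :
    ν Set.univ * ENNReal.ofReal (Real.exp (m * a)) ≤
      ∫⁻ x, ENNReal.ofReal (Real.exp (X x * a)) ∂ν := by
  by_cases hfin : ∫⁻ x, ENNReal.ofReal (Real.exp (X x * a)) ∂ν = ∞
  · simp [hfin]
  have hint : Integrable (fun x => Real.exp (X x * a)) ν := by
    refine ⟨by fun_prop, ?_⟩
    rw [hasFiniteIntegral_iff_ofReal (.of_forall fun x => (Real.exp_pos _).le)]
    exact lt_top_iff_ne_top.2 hfin
  rw [← ofReal_integral_eq_lintegral_ofReal hint (.of_forall fun x => (Real.exp_pos _).le)]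
  -- The integrand is the tangent line of the exponential at the mean `m`; its linear term
  -- integrates to zero.
  have hlin : Integrable (fun x => Real.exp (m * a) * (1 + (X x - m) * a)) ν :=
    (((integrable_const _).add ((hX.sub (integrable_const m)).mul_const a))).const_mul _
  have hle : ∫ x, Real.exp (m * a) * (1 + (X x - m) * a) ∂ν ≤ ∫ x, Real.exp (X x * a) ∂ν := by
    refine integral_mono hlin hint fun x => ?_
    have h1 : X x * a = m * a + (X x - m) * a := by ring
    simp only
    rw [h1, Real.exp_add]
    gcongr
    linarith [Real.add_one_le_exp ((X x - m) * a)]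
  have hval : ∫ x, Real.exp (m * a) * (1 + (X x - m) * a) ∂ν =
      Real.exp (m * a) * ν.real Set.univ := by
    have hXm' : Integrable (fun x => X x - m) ν := hX.sub (integrable_const m)
    rw [integral_const_mul, integral_add (integrable_const _) (hXm'.mul_const a),
      integral_mul_const,
      integral_sub hX (integrable_const m), hm]
    simp [mul_comm]
  rw [hval] at hle
  calc ν Set.univ * ENNReal.ofReal (Real.exp (m * a))
      = ENNReal.ofReal (Real.exp (m * a) * ν.real Set.univ) := by
        rw [ENNReal.ofReal_mul (Real.exp_pos _).le, mul_comm, ofReal_measureReal]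
    _ ≤ _ := ENNReal.ofReal_le_ofReal hle

/-! ### The chi distribution and its mean -/

/-- The density of the norm of a standard Gaussian vector in `ℝ^(k+1)`, up to normalization. -/
noncomputable def chiMeasure (k : ℕ) : Measure ℝ :=
  (volume.restrict (Set.Ioi 0)).withDensity
    fun r => ENNReal.ofReal (r ^ k * Real.exp (-(1 / 2) * r ^ 2))

lemma integrableOn_pow_mul_exp_neg_sq (k : ℕ) :
    IntegrableOn (fun r : ℝ => r ^ k * Real.exp (-(1 / 2) * r ^ 2)) (Set.Ioi 0) := by
  have := integrableOn_rpow_mul_exp_neg_mul_sq (b := 1 / 2) (by norm_num) (s := k)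
    (by linarith [Nat.cast_nonneg (α := ℝ) k])
  simpa using this

lemma integral_pow_mul_exp_neg_sq (k : ℕ) :
    ∫ r in Set.Ioi (0 : ℝ), r ^ k * Real.exp (-(1 / 2) * r ^ 2) =
      (1 / 2 : ℝ) ^ (-((k : ℝ) + 1) / 2) * (1 / 2) * Real.Gamma (((k : ℝ) + 1) / 2) := by
  have := integral_rpow_mul_exp_neg_mul_rpow (p := 2) (q := k) (b := 1 / 2) (by norm_num)
    (by linarith [Nat.cast_nonneg (α := ℝ) k]) (by norm_num)
  simpa using this

lemma chiMeasure_univ (k : ℕ) : chiMeasure k Set.univ =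
    ENNReal.ofReal (∫ r in Set.Ioi (0 : ℝ), r ^ k * Real.exp (-(1 / 2) * r ^ 2)) := by
  rw [chiMeasure, withDensity_apply _ MeasurableSet.univ, Measure.restrict_univ,
    ofReal_integral_eq_lintegral_ofReal (integrableOn_pow_mul_exp_neg_sq k)]
  filter_upwards [ae_restrict_mem measurableSet_Ioi] with r hr
  have : 0 < r := hr
  simp only [Pi.zero_apply]
  positivity

lemma integral_pow_mul_exp_neg_sq_pos (k : ℕ) :
    0 < ∫ r in Set.Ioi (0 : ℝ), r ^ k * Real.exp (-(1 / 2) * r ^ 2) := by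
  rw [integral_pow_mul_exp_neg_sq]
  have := Real.Gamma_pos_of_pos (s := ((k : ℝ) + 1) / 2) (by positivity)
  positivity

instance (k : ℕ) : IsFiniteMeasure (chiMeasure k) :=
  ⟨by rw [chiMeasure_univ]; exact ENNReal.ofReal_lt_top⟩

lemma chiMeasure_real_univ (k : ℕ) : (chiMeasure k).real Set.univ =
    ∫ r in Set.Ioi (0 : ℝ), r ^ k * Real.exp (-(1 / 2) * r ^ 2) := by
  rw [measureReal_def, chiMeasure_univ,
    ENNReal.toReal_ofReal (integral_pow_mul_exp_neg_sq_pos k).le]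

lemma measurable_chi_density (k : ℕ) : Measurable
    fun r : ℝ => ENNReal.ofReal (r ^ k * Real.exp (-(1 / 2) * r ^ 2)) := by fun_prop

lemma chi_smul_eqOn (k : ℕ) : Set.EqOn
    (fun r : ℝ => (ENNReal.ofReal (r ^ k * Real.exp (-(1 / 2) * r ^ 2))).toReal • r)
    (fun r : ℝ => r ^ (k + 1) * Real.exp (-(1 / 2) * r ^ 2)) (Set.Ioi 0) := by
  intro r hr
  have : 0 < r := hr
  simp only
  rw [ENNReal.toReal_ofReal (by positivity), smul_eq_mul]
  ring

lemma integrable_id_chiMeasure (k : ℕ) : Integrable (fun r : ℝ => r) (chiMeasure k) := by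
  rw [chiMeasure, integrable_withDensity_iff_integrable_smul' (measurable_chi_density k)
    (.of_forall fun _ => ENNReal.ofReal_lt_top)]
  exact (integrableOn_congr_fun (chi_smul_eqOn k) measurableSet_Ioi).2
    (integrableOn_pow_mul_exp_neg_sq (k + 1))

lemma integral_id_chiMeasure (k : ℕ) : ∫ r, r ∂chiMeasure k =
    ∫ r in Set.Ioi (0 : ℝ), r ^ (k + 1) * Real.exp (-(1 / 2) * r ^ 2) := by
  rw [chiMeasure, integral_withDensity_eq_integral_toReal_smul (measurable_chi_density k)
    (.of_forall fun _ => ENNReal.ofReal_lt_top)]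
  exact setIntegral_congr_fun measurableSet_Ioi (chi_smul_eqOn k)

/-- The mean of the chi distribution with `k + 1` degrees of freedom is at least `√k`. -/
lemma exists_chiMeasure_mean {k : ℕ} (hk : 1 ≤ k) : ∃ m : ℝ, 0 < m ∧ (k : ℝ) ≤ m ^ 2 ∧
    ∫ r, r ∂chiMeasure k = m * (chiMeasure k).real Set.univ := by
  have hk0 : (0 : ℝ) < k := by exact_mod_cast hk
  have hG1 := Real.Gamma_pos_of_pos (s := (k : ℝ) / 2) (by positivity)
  have hG2 := Real.Gamma_pos_of_pos (s := ((k : ℝ) + 1) / 2) (by positivity)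
  have hG3 := Real.Gamma_pos_of_pos (s := ((k : ℝ) + 2) / 2) (by positivity)
  have hrec : Real.Gamma (((k : ℝ) + 2) / 2) = k / 2 * Real.Gamma ((k : ℝ) / 2) := by
    rw [← Real.Gamma_add_one (by positivity)]; congr 1; ring
  -- Midpoint log-convexity of `Γ` between `k/2` and `k/2 + 1`. Together with `Γ(k/2 + 1) = (k/2)
  -- Γ(k/2)` it yields `k ≤ m ^ 2`.
  have hconv := Real.Gamma_mul_add_mul_le_rpow_Gamma_mul_rpow_Gamma (s := (k : ℝ) / 2)
    (t := ((k : ℝ) + 2) / 2) (a := 1 / 2) (b := 1 / 2) (by positivity) (by positivity)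
    (by norm_num) (by norm_num) (by norm_num)
  rw [show (1 / 2 : ℝ) * (k / 2) + 1 / 2 * ((k + 2) / 2) = (k + 1) / 2 by ring,
    ← Real.sqrt_eq_rpow, ← Real.sqrt_eq_rpow, ← Real.sqrt_mul hG1.le] at hconv
  have hsq : Real.Gamma (((k : ℝ) + 1) / 2) ^ 2 ≤
      Real.Gamma ((k : ℝ) / 2) * Real.Gamma (((k : ℝ) + 2) / 2) := by
    rwa [← Real.le_sqrt' hG2]
  refine ⟨√2 * Real.Gamma (((k : ℝ) + 2) / 2) / Real.Gamma (((k : ℝ) + 1) / 2),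
    by positivity, ?_, ?_⟩
  · rw [div_pow, mul_pow, Real.sq_sqrt (by norm_num), le_div_iff₀ (by positivity)]
    calc (k : ℝ) * Real.Gamma (((k : ℝ) + 1) / 2) ^ 2
        ≤ k * (Real.Gamma ((k : ℝ) / 2) * Real.Gamma (((k : ℝ) + 2) / 2)) := by gcongr
      _ = _ := by rw [hrec]; ring
  · rw [integral_id_chiMeasure, chiMeasure_real_univ, integral_pow_mul_exp_neg_sq,
      integral_pow_mul_exp_neg_sq]
    push_cast
    rw [show -((k : ℝ) + 1 + 1) / 2 = -(1 / 2) + -((k : ℝ) + 1) / 2 by ring,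
      Real.rpow_add (by norm_num), show ((k : ℝ) + 1 + 1) / 2 = (k + 2) / 2 by ring]
    have : (1 / 2 : ℝ) ^ (-(1 / 2) : ℝ) = √2 := by
      rw [Real.rpow_neg (by norm_num), ← Real.inv_rpow (by norm_num), Real.sqrt_eq_rpow]
      norm_num
    rw [this]
    field_simp

/-! ### Gaussian integrals and polar coordinates -/

/-- Integration in polar coordinates against the Gaussian weight. -/
lemma lintegral_exp_neg_sq_mul {k : ℕ} {f : Pt (k + 1) → ℝ≥0∞} (hf : Measurable f) :
    ∫⁻ x, ENNReal.ofReal (Real.exp (-(1 / 2) * ‖x‖ ^ 2)) * f x =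
      ∫⁻ u : Metric.sphere (0 : Pt (k + 1)) 1, ∫⁻ r, f (r • (u : Pt (k + 1))) ∂chiMeasure k
        ∂(volume : Measure (Pt (k + 1))).toSphere := by
  have hdim : Module.finrank ℝ (Pt (k + 1)) - 1 = k := by simp
  have hmp := (volume : Measure (Pt (k + 1))).measurePreserving_homeomorphUnitSphereProd
  rw [hdim] at hmp
  set F : Pt (k + 1) → ℝ≥0∞ := fun x => ENNReal.ofReal (Real.exp (-(1 / 2) * ‖x‖ ^ 2)) * f x with hF
  have hFm : Measurable F := by fun_prop
  have h1 : ∫⁻ x, F x = ∫⁻ x : (({0}ᶜ : Set (Pt (k + 1)))), F x.1 ∂(Measure.comap Subtype.val volume) := by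
    rw [lintegral_subtype_comap (measurableSet_singleton _).compl, restrict_compl_singleton]
  have h2 : ∫⁻ x : (({0}ᶜ : Set (Pt (k + 1)))), F x.1 ∂(Measure.comap Subtype.val volume) =
      ∫⁻ p, F (p.2.1 • (p.1 : Pt (k + 1))) ∂((volume : Measure (Pt (k + 1))).toSphere.prod
        (Measure.volumeIoiPow k)) := by
    rw [← hmp.lintegral_comp (by fun_prop)]
    refine lintegral_congr fun x => ?_
    have hx : ‖(x : Pt (k + 1))‖ ≠ 0 := norm_ne_zero_iff.2 x.2
    simp [smul_smul, hx]
  rw [h1, h2, lintegral_prod _ (by fun_prop)]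
  refine lintegral_congr fun u => ?_
  have hu : ‖(u : Pt (k + 1))‖ = 1 := by simp
  rw [Measure.volumeIoiPow, lintegral_withDensity_eq_lintegral_mul _ (by fun_prop) (by fun_prop),
    chiMeasure, lintegral_withDensity_eq_lintegral_mul _ (by fun_prop) (by fun_prop)]
  simp only [Pi.mul_apply]
  rw [lintegral_subtype_comap measurableSet_Ioi
    (f := fun r : ℝ => ENNReal.ofReal (r ^ k) * F (r • (u : Pt (k + 1))))]
  refine setLIntegral_congr_fun measurableSet_Ioi fun r hr => ?_
  have hr0 : 0 < r := hr
  simp only [hF]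
  rw [norm_smul, hu, ENNReal.ofReal_mul (by positivity), mul_assoc]
  simp

/-- A Gaussian integral with a linear term. -/
lemma lintegral_exp_neg_sq_mul_exp_inner {n : ℕ} {b : ℝ} (hb : 0 < b) (w : Pt n) :
    ∫⁻ x : Pt n, ENNReal.ofReal (Real.exp (-b * ‖x‖ ^ 2)) *
        ENNReal.ofReal (Real.exp (inner ℝ x w)) =
      ENNReal.ofReal ((Real.pi / b) ^ ((n : ℝ) / 2) * Real.exp (‖w‖ ^ 2 / (4 * b))) := by
  -- Completing the square; the shift disappears by translation invariance.
  have h1 : ∀ x : Pt n, ENNReal.ofReal (Real.exp (-b * ‖x‖ ^ 2)) *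
        ENNReal.ofReal (Real.exp (inner ℝ x w)) =
      ENNReal.ofReal (Real.exp (‖w‖ ^ 2 / (4 * b))) *
        ENNReal.ofReal (Real.exp (-b * ‖x - (1 / (2 * b)) • w‖ ^ 2)) := by
    intro x
    rw [← ENNReal.ofReal_mul (Real.exp_pos _).le, ← ENNReal.ofReal_mul (Real.exp_pos _).le,
      ← Real.exp_add, ← Real.exp_add, norm_sub_sq_real, norm_smul, inner_smul_right, mul_pow,
      Real.norm_eq_abs, sq_abs]
    congr 2
    field_simp
    ring
  have hint : Integrable (fun x : Pt n => Real.exp (-b * ‖x‖ ^ 2)) := by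
    by_contra h
    have h2 := GaussianFourier.integral_rexp_neg_mul_sq_norm (V := Pt n) hb
    rw [integral_undef h] at h2
    exact absurd h2 (by positivity)
  simp_rw [h1]
  rw [lintegral_const_mul _ (by fun_prop),
    lintegral_sub_right_eq_self (fun x : Pt n => ENNReal.ofReal (Real.exp (-b * ‖x‖ ^ 2))),
    ← ofReal_integral_eq_lintegral_ofReal hint (.of_forall fun _ => (Real.exp_pos _).le),
    GaussianFourier.integral_rexp_neg_mul_sq_norm hb, ← ENNReal.ofReal_mul (Real.exp_pos _).le]
  simp [mul_comm]

/-! ### Exponential moments of uniform points on the sphere -/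

instance (n : ℕ) : IsProbabilityMeasure (uniformSphere (n + 1)) := by
  have : Nontrivial (Pt (n + 1)) := inferInstance
  have h0 := Measure.toSphere_ne_zero (volume : Measure (Pt (n + 1)))
  refine ⟨?_⟩
  rw [uniformSphere, Measure.smul_apply, smul_eq_mul]
  exact ENNReal.inv_mul_cancel (by simpa only [ne_eq, Measure.measure_univ_eq_zero] using h0)
    (measure_ne_top _ _)

/-- Uniform points of the unit sphere of `ℝ^(k+1)` are sub-Gaussian with variance proxy `1/k`. -/
lemma lintegral_exp_inner_uniformSphere_le {k : ℕ} (hk : 1 ≤ k) (h : Pt (k + 1)) :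
    ∫⁻ u, ENNReal.ofReal (Real.exp (inner ℝ h (u : Pt (k + 1)))) ∂uniformSphere (k + 1) ≤
      ENNReal.ofReal (Real.exp (‖h‖ ^ 2 / (2 * k))) := by
  obtain ⟨m, hm0, hmk, hm⟩ := exists_chiMeasure_mean hk
  have hk0 : (0 : ℝ) < k := by exact_mod_cast hk
  set σ := (volume : Measure (Pt (k + 1))).toSphere with hσ
  set w : Pt (k + 1) := m⁻¹ • h with hw
  set Z := chiMeasure k Set.univ with hZ
  have hZ0 : Z ≠ 0 := by
    rw [hZ, chiMeasure_univ]; simpa using integral_pow_mul_exp_neg_sq_pos k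
  have hZt : Z ≠ ∞ := measure_ne_top _ _
  have hS0 : σ Set.univ ≠ 0 := by
    simpa only [ne_eq, Measure.measure_univ_eq_zero] using Measure.toSphere_ne_zero _
  have hSt : σ Set.univ ≠ ∞ := measure_ne_top _ _
  set G : ℝ := (Real.pi / (1 / 2)) ^ (((k + 1 : ℕ) : ℝ) / 2) with hG
  have hGpos : 0 < G := by positivity
  -- Surface mass times chi mass is the Gaussian mass, so all normalizing constants cancel at the
  -- end.
  have hmass : σ Set.univ * Z = ENNReal.ofReal G := by
    have h1 := lintegral_exp_neg_sq_mul (k := k) (f := fun _ => 1) measurable_const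
    have h2 := lintegral_exp_neg_sq_mul_exp_inner (n := k + 1) (b := 1 / 2) (by norm_num) 0
    simp only [lintegral_const, one_mul, inner_zero_right, Real.exp_zero, ENNReal.ofReal_one,
      norm_zero, ne_eq, OfNat.ofNat_ne_zero, not_false_eq_true, zero_pow, zero_div, mul_one]
      at h1 h2
    rw [← h2, h1, mul_comm]
  -- Jensen in the radial variable replaces `r` by its mean `m`; the scaling `w = m⁻¹ • h`
  -- compensates for that factor.
  have hmain : Z * ∫⁻ u, ENNReal.ofReal (Real.exp (inner ℝ h (u : Pt (k + 1)))) ∂σ ≤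
      ENNReal.ofReal (G * Real.exp (‖w‖ ^ 2 / 2)) := by
    have h2 := lintegral_exp_neg_sq_mul_exp_inner (n := k + 1) (b := 1 / 2) (by norm_num) w
    rw [lintegral_exp_neg_sq_mul (by fun_prop)] at h2
    rw [show (4 * (1 / 2) : ℝ) = 2 by norm_num] at h2
    rw [← h2, ← lintegral_const_mul _ (by fun_prop)]
    refine lintegral_mono fun u => ?_
    have h3 := measure_univ_mul_exp_le_lintegral_exp (chiMeasure k) measurable_id
      (integrable_id_chiMeasure k) hm (inner ℝ (u : Pt (k + 1)) w)
    have h4 : inner ℝ h (u : Pt (k + 1)) = m * inner ℝ (u : Pt (k + 1)) w := by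
      rw [hw, inner_smul_right, real_inner_comm]; field_simp
    simp only [real_inner_smul_left]
    rw [h4]
    exact h3
  have hexp : Real.exp (‖w‖ ^ 2 / 2) ≤ Real.exp (‖h‖ ^ 2 / (2 * k)) := by
    rw [Real.exp_le_exp, hw, norm_smul, mul_pow, norm_inv, inv_pow, Real.norm_eq_abs, sq_abs,
      inv_mul_eq_div, div_div, mul_comm]
    gcongr
  rw [uniformSphere, lintegral_smul_measure, smul_eq_mul]
  calc (σ Set.univ)⁻¹ * ∫⁻ u, ENNReal.ofReal (Real.exp (inner ℝ h (u : Pt (k + 1)))) ∂σ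
      = (σ Set.univ * Z)⁻¹ *
        (Z * ∫⁻ u, ENNReal.ofReal (Real.exp (inner ℝ h (u : Pt (k + 1)))) ∂σ) := by
        rw [ENNReal.mul_inv (.inl hS0) (.inl hSt), mul_assoc, ← mul_assoc Z⁻¹,
          ENNReal.inv_mul_cancel hZ0 hZt, one_mul]
    _ ≤ (ENNReal.ofReal G)⁻¹ * ENNReal.ofReal (G * Real.exp (‖w‖ ^ 2 / 2)) := by
        rw [hmass]; gcongr
    _ = ENNReal.ofReal (Real.exp (‖w‖ ^ 2 / 2)) := by
        rw [ENNReal.ofReal_mul hGpos.le, ← mul_assoc, ENNReal.inv_mul_cancel (by simpa using hGpos)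
          ENNReal.ofReal_ne_top, one_mul]
    _ ≤ _ := ENNReal.ofReal_le_ofReal hexp

instance (n M : ℕ) : IsProbabilityMeasure (sphereSample (n + 1) M) := by
  unfold sphereSample; infer_instance

lemma lintegral_exp_inner_sum_le {k M : ℕ} (hk : 1 ≤ k) (T : Finset (Fin M)) (h : Pt (k + 1)) :
    ∫⁻ u, ENNReal.ofReal (Real.exp (inner ℝ h (∑ i ∈ T, (u i : Pt (k + 1)))))
        ∂sphereSample (k + 1) M ≤
      ENNReal.ofReal (Real.exp (T.card * ‖h‖ ^ 2 / (2 * k))) := by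
  set g : Metric.sphere (0 : Pt (k + 1)) 1 → ℝ≥0∞ :=
    fun v => ENNReal.ofReal (Real.exp (inner ℝ h (v : Pt (k + 1)))) with hg
  have hgm : Measurable g := by fun_prop
  have h1 : ∀ u : Fin M → Metric.sphere (0 : Pt (k + 1)) 1,
      ENNReal.ofReal (Real.exp (inner ℝ h (∑ i ∈ T, (u i : Pt (k + 1))))) =
        ∏ i ∈ T, g (u i) := by
    intro u
    rw [inner_sum, Real.exp_sum, ENNReal.ofReal_prod_of_nonneg fun _ _ => (Real.exp_pos _).le]
  have hind : ProbabilityTheory.iIndepFun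
      (fun i (u : Fin M → Metric.sphere (0 : Pt (k + 1)) 1) => g (u i))
      (sphereSample (k + 1) M) :=
    ProbabilityTheory.iIndepFun_pi fun _ => hgm.aemeasurable
  simp_rw [h1]
  rw [ProbabilityTheory.lintegral_prod_eq_prod_lintegral_of_indepFun T _ hind
    fun i => by fun_prop]
  have h2 : ∀ i ∈ T, ∫⁻ u, g (u i) ∂sphereSample (k + 1) M ≤
      ENNReal.ofReal (Real.exp (‖h‖ ^ 2 / (2 * k))) := by
    intro i _
    have hmp : MeasurePreserving (fun u : Fin M → Metric.sphere (0 : Pt (k + 1)) 1 => u i)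
      (sphereSample (k + 1) M) (uniformSphere (k + 1)) := measurePreserving_eval _ i
    rw [hmp.lintegral_comp hgm]
    exact lintegral_exp_inner_uniformSphere_le hk h
  calc _ ≤ ∏ _i ∈ T, ENNReal.ofReal (Real.exp (‖h‖ ^ 2 / (2 * k))) := Finset.prod_le_prod' h2
    _ = _ := by
      rw [Finset.prod_const, ← ENNReal.ofReal_pow (Real.exp_pos _).le, ← Real.exp_nat_mul,
        mul_div_assoc]

/-- An exponential moment of the squared norm of a sum of uniform points of the sphere. -/
lemma lintegral_exp_norm_sum_sq_le {k M : ℕ} (hk : 1 ≤ k) (T : Finset (Fin M)) {b : ℝ}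
    (hb : (T.card : ℝ) / (2 * k) < b) :
    ∫⁻ u, ENNReal.ofReal (Real.exp (‖∑ i ∈ T, (u i : Pt (k + 1))‖ ^ 2 / (4 * b)))
        ∂sphereSample (k + 1) M ≤
      ENNReal.ofReal ((b / (b - T.card / (2 * k))) ^ (((k + 1 : ℕ) : ℝ) / 2)) := by
  have hb0 : 0 < b := lt_of_le_of_lt (by positivity) hb
  have hc : 0 < b - T.card / (2 * k) := sub_pos.2 hb
  have hpi := Real.pi_pos
  set G : ℝ := (Real.pi / b) ^ (((k + 1 : ℕ) : ℝ) / 2) with hG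
  have hGpos : 0 < G := by positivity
  -- The exponential of the squared norm is itself a Gaussian integral of `exp ⟪x, ∑ u i⟫` over `x`.
  -- After swapping integrals, the sub-Gaussian bound only lowers the Gaussian parameter from `b` to
  -- `b - T.card / (2 * k)`.
  have hkey : ENNReal.ofReal G *
      ∫⁻ u, ENNReal.ofReal (Real.exp (‖∑ i ∈ T, (u i : Pt (k + 1))‖ ^ 2 / (4 * b)))
        ∂sphereSample (k + 1) M ≤
      ENNReal.ofReal ((Real.pi / (b - T.card / (2 * k))) ^ (((k + 1 : ℕ) : ℝ) / 2)) := by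
    rw [← lintegral_const_mul _ (by fun_prop)]
    simp_rw [← ENNReal.ofReal_mul hGpos.le, hG, ← lintegral_exp_neg_sq_mul_exp_inner hb0]
    rw [lintegral_lintegral_swap (by fun_prop)]
    have h0 := lintegral_exp_neg_sq_mul_exp_inner (n := k + 1) hc 0
    simp only [inner_zero_right, Real.exp_zero, ENNReal.ofReal_one, norm_zero, ne_eq,
      OfNat.ofNat_ne_zero, not_false_eq_true, zero_pow, zero_div, mul_one] at h0
    rw [← h0]
    refine lintegral_mono fun x => ?_
    simp only
    rw [lintegral_const_mul _ (by fun_prop)]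
    calc _ ≤ ENNReal.ofReal (Real.exp (-b * ‖x‖ ^ 2)) *
          ENNReal.ofReal (Real.exp (T.card * ‖x‖ ^ 2 / (2 * k))) := by
          gcongr; exact lintegral_exp_inner_sum_le hk T x
      _ = _ := by
          rw [← ENNReal.ofReal_mul (Real.exp_pos _).le, ← Real.exp_add]
          congr 2
          ring
  have hG0 : ENNReal.ofReal G ≠ 0 := by simpa using hGpos
  have hdiv : (b / (b - T.card / (2 * k))) ^ (((k + 1 : ℕ) : ℝ) / 2) =
      G⁻¹ * (Real.pi / (b - T.card / (2 * k))) ^ (((k + 1 : ℕ) : ℝ) / 2) := by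
    rw [hG, ← Real.inv_rpow (by positivity), ← Real.mul_rpow (by positivity) (by positivity)]
    congr 1
    field_simp
  rw [hdiv, ENNReal.ofReal_mul (by positivity), ENNReal.ofReal_inv_of_pos hGpos,
    ← ENNReal.mul_le_iff_le_inv hG0 ENNReal.ofReal_ne_top]
  exact hkey

/-- The large deviation bound for the norm of a sum of uniform points of the sphere. -/
lemma sphereSample_norm_sum_sq_ge_le {k M : ℕ} (hk : 1 ≤ k) {T : Finset (Fin M)}
    (hT : T.Nonempty) {t : ℝ} (ht : 1 ≤ t) :
    sphereSample (k + 1) M {u | (T.card : ℝ) * t ≤ ‖∑ i ∈ T, (u i : Pt (k + 1))‖ ^ 2} ≤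
      ENNReal.ofReal (Real.exp ((t - 1) / 2) *
        Real.exp (-(((k + 1 : ℕ) : ℝ) / 2 * (t - 1 - Real.log t)))) := by
  rcases ht.eq_or_lt with rfl | ht
  · simpa using prob_le_one
  have hk0 : (0 : ℝ) < k := by exact_mod_cast hk
  have hT0 : (0 : ℝ) < T.card := by exact_mod_cast hT.card_pos
  have ht1 : 0 < t - 1 := sub_pos.2 ht
  have ht0 : 0 < t := by linarith
  -- Chosen so that `b / (b - T.card / (2 * k)) = t`, the Chernoff optimum up to `k` in place of `k
  -- + 1`; that discrepancy costs the bounded factor `exp((t - 1) / 2)`. It needs `t > 1`, hence the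
  -- separate case `t = 1`.
  set b : ℝ := T.card * t / (2 * k * (t - 1)) with hb
  have hbpos : 0 < b := by positivity
  have hbsub : b - T.card / (2 * k) = T.card / (2 * k * (t - 1)) := by
    rw [hb]; field_simp; ring
  have hlt : (T.card : ℝ) / (2 * k) < b := by
    rw [← sub_pos, hbsub]; positivity
  have hmgf := lintegral_exp_norm_sum_sq_le (M := M) hk T hlt
  have hratio : b / (b - T.card / (2 * k)) = t := by
    rw [hbsub, hb]; field_simp
  rw [hratio] at hmgf
  have hsub : {u : Fin M → Metric.sphere (0 : Pt (k + 1)) 1 |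
        (T.card : ℝ) * t ≤ ‖∑ i ∈ T, (u i : Pt (k + 1))‖ ^ 2} ⊆
      {u | ENNReal.ofReal (Real.exp (T.card * t / (4 * b))) ≤
        ENNReal.ofReal (Real.exp (‖∑ i ∈ T, (u i : Pt (k + 1))‖ ^ 2 / (4 * b)))} := by
    intro u hu
    have hu' : (T.card : ℝ) * t ≤ ‖∑ i ∈ T, (u i : Pt (k + 1))‖ ^ 2 := hu
    refine ENNReal.ofReal_le_ofReal (Real.exp_le_exp.2 ?_)
    gcongr
  refine (measure_mono hsub).trans ((meas_ge_le_lintegral_div (Measurable.aemeasurable (by fun_prop))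
    (by simpa using Real.exp_pos _) ENNReal.ofReal_ne_top).trans ?_)
  rw [ENNReal.div_le_iff (by simpa using Real.exp_pos _) ENNReal.ofReal_ne_top,
    ← ENNReal.ofReal_mul (by positivity)]
  refine hmgf.trans (ENNReal.ofReal_le_ofReal (le_of_eq ?_))
  rw [Real.rpow_def_of_pos ht0, ← Real.exp_add, ← Real.exp_add]
  congr 1
  rw [hb]
  push_cast
  field_simp
  ring

/-! ### Almost sure distinctness of the sampled points -/

open scoped Pointwise in
lemma toSphere_singleton {k : ℕ} (hk : 1 ≤ k) (v : Metric.sphere (0 : Pt (k + 1)) 1) :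
    (volume : Measure (Pt (k + 1))).toSphere {v} = 0 := by
  rw [Measure.toSphere_apply' _ (measurableSet_singleton v), Set.image_singleton]
  have hspan : Submodule.span ℝ {(v : Pt (k + 1))} ≠ ⊤ := by
    intro h
    have h1 := finrank_span_le_card (R := ℝ) ({(v : Pt (k + 1))} : Set (Pt (k + 1)))
    rw [h, finrank_top, finrank_euclideanSpace_fin] at h1
    simp at h1
    omega
  have h0 := Measure.addHaar_submodule (volume : Measure (Pt (k + 1))) _ hspan
  -- `toSphere` measures `{v}` through the volume of the open segment from `0` to `v`, which lies in
  -- a line, null in dimension at least two.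
  have hsub : Set.Ioo (0 : ℝ) 1 • ({(v : Pt (k + 1))} : Set (Pt (k + 1))) ⊆
      (Submodule.span ℝ {(v : Pt (k + 1))} : Set (Pt (k + 1))) := by
    rintro _ ⟨r, _, x, hx, rfl⟩
    exact Submodule.smul_mem _ r (Submodule.subset_span hx)
  rw [measure_mono_null hsub h0, mul_zero]

lemma uniformSphere_singleton {k : ℕ} (hk : 1 ≤ k) (v : Metric.sphere (0 : Pt (k + 1)) 1) :
    uniformSphere (k + 1) {v} = 0 := by
  rw [uniformSphere, Measure.smul_apply, toSphere_singleton hk, smul_zero]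

lemma sphereSample_eq_eq_zero {k M : ℕ} (hk : 1 ≤ k) {i j : Fin M} (hij : i ≠ j) :
    sphereSample (k + 1) M {u | u i = u j} = 0 := by
  have hind : ProbabilityTheory.iIndepFun
      (fun i (u : Fin M → Metric.sphere (0 : Pt (k + 1)) 1) => u i) (sphereSample (k + 1) M) :=
    ProbabilityTheory.iIndepFun_pi (X := fun _ v => v) fun _ => aemeasurable_id
  have hpair := (ProbabilityTheory.indepFun_iff_map_prod_eq_prod_map_map
    (measurable_pi_apply i).aemeasurable (measurable_pi_apply j).aemeasurable).1 (hind.indepFun hij)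
  have hmap : ∀ i : Fin M, (sphereSample (k + 1) M).map (fun u => u i) = uniformSphere (k + 1) :=
    fun i => (measurePreserving_eval (fun _ : Fin M => uniformSphere (k + 1)) i).map_eq
  rw [hmap, hmap] at hpair
  have hdiag : MeasurableSet {p : Metric.sphere (0 : Pt (k + 1)) 1 ×
      Metric.sphere (0 : Pt (k + 1)) 1 | p.1 = p.2} :=
    measurableSet_eq_fun measurable_fst measurable_snd
  have hzero : ((uniformSphere (k + 1)).prod (uniformSphere (k + 1)))
      {p | p.1 = p.2} = 0 := by
    rw [Measure.measure_prod_null hdiag]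
    refine .of_forall fun v => ?_
    have : Prod.mk v ⁻¹' {p : Metric.sphere (0 : Pt (k + 1)) 1 ×
        Metric.sphere (0 : Pt (k + 1)) 1 | p.1 = p.2} = {v} := by
      ext w; simp [eq_comm]
    simp only [this, uniformSphere_singleton hk, Pi.zero_apply]
  rw [← hpair, Measure.map_apply (by fun_prop) hdiag] at hzero
  exact hzero

lemma ae_injective_sphereSample {k M : ℕ} (hk : 1 ≤ k) :
    ∀ᵐ u ∂sphereSample (k + 1) M, Function.Injective u := by
  have h : ∀ᵐ u ∂sphereSample (k + 1) M, ∀ i j : Fin M, i ≠ j → u i ≠ u j := by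
    simp only [ae_all_iff]
    exact fun i j hij => by
      rw [ae_iff]
      simpa using sphereSample_eq_eq_zero hk hij
  filter_upwards [h] with u hu i j hij
  by_contra hne
  exact hu i j hne hij

/-! ### Counting heavy index sets by the first moment -/

open Classical in
/-- The `L`-element index sets whose points have a sum of squared norm at least `s`. -/
noncomputable def heavyIndexSets {n M : ℕ} (L : ℕ) (s : ℝ)
    (u : Fin M → Metric.sphere (0 : Pt n) 1) : Finset (Finset (Fin M)) :=
  {T ∈ Finset.powersetCard L Finset.univ | s ≤ ‖∑ i ∈ T, (u i : Pt n)‖ ^ 2}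

lemma choose_le_mul_pow (m l : ℕ) : (m + 1).choose (l + 1) ≤ (m + 1) * m ^ l := by
  calc (m + 1).choose (l + 1) ≤ (m + 1).descFactorial (l + 1) := by
        rw [Nat.descFactorial_eq_factorial_mul_choose]
        exact Nat.le_mul_of_pos_left _ (Nat.factorial_pos _)
    _ = (m + 1) * m.descFactorial l := Nat.succ_descFactorial_succ m l
    _ ≤ _ := Nat.mul_le_mul_left _ (Nat.descFactorial_le_pow m l)

/-- Markov's inequality at threshold `M/2` cancels the factor `M = m + 1` of the count, leaving
exponent `l = L - 1`. -/
lemma sphereSample_many_heavy_le {k m l : ℕ} (hk : 1 ≤ k) {t : ℝ} (ht : 1 ≤ t) :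
    sphereSample (k + 1) (m + 1)
        {u | ((m + 1 : ℕ) : ℝ) / 2 < (heavyIndexSets (l + 1) (((l + 1 : ℕ) : ℝ) * t) u).card} ≤
      ENNReal.ofReal (2 * (m : ℝ) ^ l * (Real.exp ((t - 1) / 2) *
        Real.exp (-(((k + 1 : ℕ) : ℝ) / 2 * (t - 1 - Real.log t))))) := by
  classical
  set μ := sphereSample (k + 1) (m + 1)
  set p : ℝ := Real.exp ((t - 1) / 2) *
    Real.exp (-(((k + 1 : ℕ) : ℝ) / 2 * (t - 1 - Real.log t))) with hp
  have hp0 : 0 < p := by positivity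
  set A : Finset (Fin (m + 1)) → Set (Fin (m + 1) → Metric.sphere (0 : Pt (k + 1)) 1) :=
    fun T => {u | ((l + 1 : ℕ) : ℝ) * t ≤ ‖∑ i ∈ T, (u i : Pt (k + 1))‖ ^ 2} with hA
  have hAm : ∀ T, MeasurableSet (A T) := fun T => by
    have hm : Measurable fun u : Fin (m + 1) → Metric.sphere (0 : Pt (k + 1)) 1 =>
      ‖∑ i ∈ T, (u i : Pt (k + 1))‖ ^ 2 := by fun_prop
    exact measurableSet_le measurable_const hm
  set 𝒯 : Finset (Finset (Fin (m + 1))) := Finset.powersetCard (l + 1) Finset.univ with h𝒯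
  set F : (Fin (m + 1) → Metric.sphere (0 : Pt (k + 1)) 1) → ℝ≥0∞ :=
    fun u => ∑ T ∈ 𝒯, (A T).indicator 1 u with hF
  have hFm : Measurable F :=
    Finset.measurable_fun_sum _ fun T _ => measurable_one.indicator (hAm T)
  have hcard : ∀ u, ((heavyIndexSets (l + 1) (((l + 1 : ℕ) : ℝ) * t) u).card : ℝ≥0∞) = F u := by
    intro u
    rw [heavyIndexSets, Finset.card_filter]
    push_cast
    refine Finset.sum_congr rfl fun T _ => ?_
    simp [Set.indicator_apply, hA]
  have hint : ∫⁻ u, F u ∂μ ≤ ENNReal.ofReal ((m + 1) * (m : ℝ) ^ l * p) := by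
    rw [hF, lintegral_finsetSum _ fun T _ => measurable_one.indicator (hAm T)]
    calc ∑ T ∈ 𝒯, ∫⁻ u, (A T).indicator 1 u ∂μ ≤ ∑ _T ∈ 𝒯, ENNReal.ofReal p := by
          refine Finset.sum_le_sum fun T hT => ?_
          rw [lintegral_indicator_one (hAm T)]
          have hTc : T.card = l + 1 := (Finset.mem_powersetCard.1 hT).2
          have := sphereSample_norm_sum_sq_ge_le hk
            (Finset.card_pos.1 (by omega : 0 < T.card)) ht
          rwa [hTc] at this
      _ = ENNReal.ofReal ((m + 1).choose (l + 1) * p) := by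
          rw [Finset.sum_const, h𝒯, Finset.card_powersetCard, Finset.card_univ, Fintype.card_fin,
            ENNReal.ofReal_mul (Nat.cast_nonneg _), ENNReal.ofReal_natCast, nsmul_eq_mul]
      _ ≤ _ := by
          gcongr
          exact_mod_cast choose_le_mul_pow m l
  have hpos : (0 : ℝ) < ((m + 1 : ℕ) : ℝ) / 2 := by positivity
  calc μ _ ≤ μ {u | ENNReal.ofReal (((m + 1 : ℕ) : ℝ) / 2) ≤ F u} := by
        refine measure_mono fun u hu => ?_
        have hu' : ((m + 1 : ℕ) : ℝ) / 2 <
          (heavyIndexSets (l + 1) (((l + 1 : ℕ) : ℝ) * t) u).card := hu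
        change _ ≤ F u
        rw [← hcard, ← ENNReal.ofReal_natCast]
        exact ENNReal.ofReal_le_ofReal hu'.le
    _ ≤ (∫⁻ u, F u ∂μ) / ENNReal.ofReal (((m + 1 : ℕ) : ℝ) / 2) :=
        meas_ge_le_lintegral_div hFm.aemeasurable (by simpa using hpos) ENNReal.ofReal_ne_top
    _ ≤ ENNReal.ofReal ((m + 1) * (m : ℝ) ^ l * p) / ENNReal.ofReal (((m + 1 : ℕ) : ℝ) / 2) := by
        gcongr
    _ = _ := by
        rw [← ENNReal.ofReal_div_of_pos hpos]
        congr 1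
        push_cast
        field_simp

/-! ### Bad lists and expurgation -/

lemma avgRadSq_eq {n : ℕ} {S : Finset (Pt n)} (hS : S.Nonempty) :
    avgRadSq S = (S.card : ℝ)⁻¹ * ∑ x ∈ S, ‖x‖ ^ 2 - ‖(S.card : ℝ)⁻¹ • ∑ x ∈ S, x‖ ^ 2 := by
  have hc : (S.card : ℝ) ≠ 0 := by exact_mod_cast hS.card_pos.ne'
  have hsum : ∑ x ∈ S, x = (S.card : ℝ) • centroid S := by
    rw [centroid, smul_smul, mul_inv_cancel₀ hc, one_smul]
  have h : ∑ x ∈ S, ‖x - centroid S‖ ^ 2 =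
      ∑ x ∈ S, ‖x‖ ^ 2 - S.card * ‖centroid S‖ ^ 2 := by
    simp_rw [norm_sub_sq_real]
    rw [Finset.sum_add_distrib, Finset.sum_sub_distrib, ← Finset.mul_sum, ← sum_inner, hsum,
      real_inner_smul_left, real_inner_self_eq_norm_sq, Finset.sum_const, nsmul_eq_mul]
    ring
  rw [avgRadSq, h, ← centroid]
  field_simp

/-- Bad lists of a spherical code come from index sets with a long sum. -/
lemma norm_sum_sq_ge_of_avgRadSq_le {n M L : ℕ} (hn : 0 < n) {P N : ℝ} (hP : 0 < P)
    (hL : 0 < L) {u : Fin M → Metric.sphere (0 : Pt n) 1} {T : Finset (Fin M)}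
    {S : Finset (Pt n)} (hTL : T.card = L) (hSL : S.card = L)
    (hST : ∀ g : Pt n → ℝ, ∑ x ∈ S, g x = ∑ i ∈ T, g (Real.sqrt (n * P) • (u i : Pt n)))
    (hST' : ∑ x ∈ S, x = Real.sqrt (n * P) • ∑ i ∈ T, (u i : Pt n))
    (hbad : avgRadSq S ≤ n * N) :
    (L : ℝ) * (L * (P - N) / P) ≤ ‖∑ i ∈ T, (u i : Pt n)‖ ^ 2 := by
  have hn0 : (0 : ℝ) < n := by exact_mod_cast hn
  have hL0 : (0 : ℝ) < L := by exact_mod_cast hL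
  have hu : ∀ i, ‖(u i : Pt n)‖ = 1 := fun i => by simp
  rw [avgRadSq_eq (Finset.card_pos.1 (by omega)), hST, hST', hSL] at hbad
  simp only [norm_smul, mul_pow, hu, Real.norm_eq_abs, sq_abs,
    Real.sq_sqrt (by positivity : 0 ≤ n * P), Finset.sum_const, hTL, nsmul_eq_mul, inv_pow] at hbad
  rw [mul_div_assoc', div_le_iff₀ hP]
  set V := ‖∑ i ∈ T, (u i : Pt n)‖ ^ 2
  -- All points have squared norm `nP`, so the radius is `nP(1 - V/L²)` and a small radius forces a
  -- large `V`.
  have h1 : (L : ℝ)⁻¹ * (L * (n * P * 1 ^ 2)) - ((L : ℝ) ^ 2)⁻¹ * (n * P * V) =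
      (n * (L ^ 2 * P - P * V)) / L ^ 2 := by
    field_simp
  rw [h1, div_le_iff₀ (by positivity), mul_assoc] at hbad
  have := le_of_mul_le_mul_left hbad hn0
  linarith

/-- A bad list surviving in `C'` would be a bad list of `C`, yet its chosen point has been removed.
-/
lemma isAvgRadListDecodable_of_isExpurgation {n L : ℕ} {P N : ℝ} {C C' : Set (Pt n)}
    (hfin : C.Finite) (hC : C ⊆ Metric.closedBall 0 (Real.sqrt (n * P)))
    (h : IsExpurgation N L C C') : IsAvgRadListDecodable P N L C' := by
  obtain ⟨c, hc, rfl⟩ := h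
  refine ⟨Set.sdiff_subset.trans hC, ?_⟩
  set D := C \ (c '' badLists N L C) with hD
  have hlist : ∀ S ∈ lists L D, ((n * N : ℝ) : EReal) < (avgRadSq S : EReal) := by
    intro S hS
    rw [EReal.coe_lt_coe_iff]
    by_contra! hle
    have hSbad : S ∈ badLists N L C := ⟨⟨hS.1.trans Set.sdiff_subset, hS.2⟩, hle⟩
    exact (hS.1 (hc S hSbad)).2 ⟨S, hSbad, rfl⟩
  -- Finiteness makes the infimum attained, which keeps the inequality strict.
  have hlfin : (lists L D).Finite := by
    have hDfin : D.Finite := hfin.subset Set.sdiff_subset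
    refine (hDfin.toFinset.powerset.finite_toSet).subset fun S hS => ?_
    simp only [Finset.mem_coe, Finset.mem_powerset]
    intro x hx
    simpa using hS.1 hx
  rw [codeAvgRadSq]
  rcases (lists L D).eq_empty_or_nonempty with he | hne
  · rw [he]; simpa using EReal.coe_lt_top (n * N)
  · obtain ⟨S, hS, hmin⟩ := hlfin.exists_minimalFor (fun S => (avgRadSq S : EReal)) _ hne
    refine (hlist S hS).trans_le (le_iInf₂ fun S' hS' => ?_)
    rcases le_total (avgRadSq S : EReal) (avgRadSq S') with h | h
    · exact h
    · exact hmin hS' h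

/-- Removed points are at most as many as bad lists, and each bad list is the image of a heavy index
set. Injectivity ensures that the code has `M` points and that index sets keep their size. -/
lemma half_le_ncard_of_isExpurgation {n M L : ℕ} (hn : 0 < n) {P N : ℝ} (hP : 0 < P)
    (hL : 0 < L) {u : Fin M → Metric.sphere (0 : Pt n) 1} (hinj : Function.Injective u)
    (hcard : ((heavyIndexSets L (L * (L * (P - N) / P)) u).card : ℝ) ≤ (M : ℝ) / 2)
    {C' : Set (Pt n)} (h : IsExpurgation N L (sphericalCode P u) C') :
    (M : ℝ) / 2 ≤ (C'.ncard : ℝ) := by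
  classical
  obtain ⟨c, hc, rfl⟩ := h
  have hn0 : (0 : ℝ) < n := by exact_mod_cast hn
  set f : Fin M → Pt n := fun i => Real.sqrt (n * P) • (u i : Pt n) with hf
  have hs : Real.sqrt (n * P) ≠ 0 := (Real.sqrt_pos.2 (by positivity)).ne'
  have hfinj : Function.Injective f := fun i j hij =>
    hinj (Subtype.ext (smul_right_injective _ hs hij))
  have hC : sphericalCode P u = Set.range f := rfl
  have hCcard : (sphericalCode P u).ncard = M := by
    rw [hC, ← Set.image_univ, Set.ncard_image_of_injective _ hfinj, Set.ncard_univ,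
      Nat.card_eq_fintype_card, Fintype.card_fin]
  have hsub : badLists N L (sphericalCode P u) ⊆
      (fun T : Finset (Fin M) => T.image f) '' (heavyIndexSets L (L * (L * (P - N) / P)) u) := by
    rintro S ⟨⟨hSC, hSL⟩, hbad⟩
    obtain ⟨T, hT⟩ : ∃ T : Finset (Fin M), T.image f = S :=
      ⟨S.preimage f hfinj.injOn, by
        rw [Finset.image_preimage]; exact Finset.filter_true_of_mem fun x hx => hSC hx⟩
    have hTL : T.card = L := by rw [← hSL, ← hT, Finset.card_image_of_injective _ hfinj]
    refine ⟨T, ?_, hT⟩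
    rw [Finset.mem_coe, heavyIndexSets, Finset.mem_filter, Finset.mem_powersetCard]
    refine ⟨⟨Finset.subset_univ _, hTL⟩,
      norm_sum_sq_ge_of_avgRadSq_le hn hP hL hTL hSL (fun g => ?_) ?_ hbad⟩
    · rw [← hT, Finset.sum_image hfinj.injOn]
    · rw [← hT, Finset.sum_image hfinj.injOn, Finset.smul_sum]
  have hfinH : ((fun T : Finset (Fin M) => T.image f) ''
      (heavyIndexSets L (L * (L * (P - N) / P)) u : Set (Finset (Fin M)))).Finite :=
    (Finset.finite_toSet _).image _
  have hbadcard : (c '' badLists N L (sphericalCode P u)).ncard ≤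
      (heavyIndexSets L (L * (L * (P - N) / P)) u).card := by
    calc _ ≤ (badLists N L (sphericalCode P u)).ncard := Set.ncard_image_le (hfinH.subset hsub)
      _ ≤ _ := Set.ncard_le_ncard hsub hfinH
      _ ≤ (heavyIndexSets L (L * (L * (P - N) / P)) u : Set (Finset (Fin M))).ncard :=
        Set.ncard_image_le (Finset.finite_toSet _)
      _ = _ := Set.ncard_coe_finset _
  have hdiff := Set.le_ncard_sdiff (c '' badLists N L (sphericalCode P u)) (sphericalCode P u)
    (((hfinH.subset hsub)).image c)
  rw [hCcard] at hdiff
  have hle : (M : ℝ) ≤ (sphericalCode P u \ c '' badLists N L (sphericalCode P u)).ncard +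
      (heavyIndexSets L (L * (L * (P - N) / P)) u).card := by
    exact_mod_cast (by omega)
  linarith

lemma sphericalCode_subset_closedBall {n M : ℕ} (P : ℝ)
    (u : Fin M → Metric.sphere (0 : Pt n) 1) :
    sphericalCode P u ⊆ Metric.closedBall 0 (Real.sqrt (n * P)) := by
  rintro _ ⟨i, rfl⟩
  simp [norm_smul, abs_of_nonneg (Real.sqrt_nonneg _)]

lemma exists_isExpurgation {n L : ℕ} (N : ℝ) (hL : 0 < L) (C : Set (Pt n)) :
    ∃ C', IsExpurgation N L C C' := by
  classical
  refine ⟨_, fun S => if h : S.Nonempty then h.choose else 0, fun S hS => ?_, rfl⟩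
  have hne : S.Nonempty := Finset.card_pos.1 (by rw [hS.1.2]; exact hL)
  simpa [hne] using hne.choose_spec

lemma le_rate_of_half_le_ncard {n M : ℕ} (hn : 0 < n) {R : ℝ} {C : Set (Pt n)} (hC : C.Finite)
    (hM : Real.exp (n * R) ≤ M) (h : (M : ℝ) / 2 ≤ C.ncard) :
    ((R - Real.log 2 / n : ℝ) : EReal) ≤ rate C := by
  have hn0 : (0 : ℝ) < n := by exact_mod_cast hn
  have hpos : (0 : ℝ) < C.ncard := lt_of_lt_of_le
    (by have := Real.exp_pos (n * R); linarith) h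
  have hlog : n * R - Real.log 2 ≤ Real.log C.ncard := by
    rw [Real.le_log_iff_exp_le hpos, Real.exp_sub, Real.exp_log (by norm_num)]
    linarith
  have hrate : rate C = ((Real.log C.ncard / n : ℝ) : EReal) := by
    rw [rate, ← hC.cast_ncard_eq]
    have : ((C.ncard : ℕ∞) : ℝ≥0∞) = ENNReal.ofReal C.ncard := by
      rw [ENNReal.ofReal_natCast]; rfl
    rw [this, ENNReal.log_ofReal_of_pos hpos, EReal.coe_div]
    rfl
  rw [hrate, EReal.coe_le_coe_iff, le_div_iff₀ hn0, sub_mul, div_mul_cancel₀ _ hn0.ne']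
  linarith

/-! ### Limit in the dimension and the capacity bound -/

/-- The event that every expurgation of the sampled code is good has probability tending to one. -/
lemma tendsto_sphereSample_expurgation {P N : ℝ} {L : ℕ} (hP : 0 < P) (hL : 2 ≤ L)
    (hNP : N / P ≤ ((L : ℝ) - 1) / L) {R : ℝ}
    (hR : R < (1 / 2 : ℝ) * (1 - L * N / (((L : ℝ) - 1) * P)
        - 1 / ((L : ℝ) - 1) * Real.log (L * (P - N) / P))) :
    Tendsto (fun n : ℕ => sphereSample n ⌈Real.exp (n * R)⌉₊
      {u | ∀ C', IsExpurgation N L (sphericalCode P u) C' → IsAvgRadListDecodable P N L C' ∧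
        (⌈Real.exp (n * R)⌉₊ : ℝ) / 2 ≤ (C'.ncard : ℝ)}) atTop (𝓝 1) := by
  obtain ⟨l, rfl⟩ : ∃ l, L = l + 1 := ⟨L - 1, by omega⟩
  have hl : 1 ≤ l := by omega
  have hl0 : (0 : ℝ) < l := by exact_mod_cast hl
  set t : ℝ := ((l + 1 : ℕ) : ℝ) * (P - N) / P with ht
  -- The hypothesis on `N / P` says exactly that `t ≥ 1`, the range of the Chernoff bound.
  have ht1 : 1 ≤ t := by
    rw [div_le_div_iff₀ hP (by positivity)] at hNP
    rw [ht, le_div_iff₀ hP]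
    linarith
  set δ : ℝ := (t - 1 - Real.log t) / 2 - l * R with hδ
  -- `δ` is `(L-1)(B - R)`, since `B = (t - 1 - log t) / (2(L-1))`.
  have hδ0 : 0 < δ := by
    have h1 : (1 / 2 : ℝ) * (1 - ((l + 1 : ℕ) : ℝ) * N / ((((l + 1 : ℕ) : ℝ) - 1) * P)
        - 1 / (((l + 1 : ℕ) : ℝ) - 1) * Real.log t) = (t - 1 - Real.log t) / 2 / l := by
      have h2 : ((l + 1 : ℕ) : ℝ) - 1 = l := by push_cast; ring
      rw [h2]
      have h3 : ((l + 1 : ℕ) : ℝ) * N / (l * P) = (((l + 1 : ℕ) : ℝ) - t) / l := by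
        rw [ht]; field_simp; ring
      rw [h3]
      push_cast
      field_simp
      ring
    rw [h1, lt_div_iff₀ hl0] at hR
    linarith
  rw [← tendsto_add_atTop_iff_nat 1]
  set ε : ℕ → ℝ := fun k => 2 * Real.exp ((t - 1) / 2) * Real.exp (-(((k + 1 : ℕ) : ℝ) * δ))
    with hε
  have hε0 : Tendsto ε atTop (𝓝 0) := by
    have h1 : Tendsto (fun k : ℕ => ((k + 1 : ℕ) : ℝ) * δ) atTop atTop :=
      ((tendsto_natCast_atTop_atTop (R := ℝ)).comp (tendsto_add_atTop_nat 1)).atTop_mul_const hδ0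
    have h2 := (Real.tendsto_exp_neg_atTop_nhds_zero.comp h1).const_mul
      (2 * Real.exp ((t - 1) / 2))
    rwa [mul_zero] at h2
  have hlow : Tendsto (fun k => 1 - ENNReal.ofReal (ε k)) atTop (𝓝 1) := by
    have := ENNReal.Tendsto.sub (tendsto_const_nhds (x := (1 : ℝ≥0∞)) (f := atTop))
      (ENNReal.tendsto_ofReal hε0) (.inl ENNReal.one_ne_top)
    simpa using this
  refine tendsto_of_tendsto_of_tendsto_of_le_of_le' hlow tendsto_const_nhds ?_
    (.of_forall fun k => prob_le_one)
  filter_upwards [eventually_ge_atTop 1] with k hk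
  obtain ⟨m, hm⟩ : ∃ m, ⌈Real.exp (((k + 1 : ℕ) : ℝ) * R)⌉₊ = m + 1 :=
    ⟨_, (Nat.succ_pred (Nat.ceil_pos.2 (Real.exp_pos _)).ne').symm⟩
  -- Counting lists with powers of `M - 1` rather than `M` absorbs the ceiling, for `R` of any sign.
  have hmle : (m : ℝ) ≤ Real.exp (((k + 1 : ℕ) : ℝ) * R) := by
    have := Nat.ceil_lt_add_one (Real.exp_pos (((k + 1 : ℕ) : ℝ) * R)).le
    rw [hm, Nat.cast_add_one] at this
    linarith
  rw [hm]
  set H := {u : Fin (m + 1) → Metric.sphere (0 : Pt (k + 1)) 1 | ((m + 1 : ℕ) : ℝ) / 2 <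
    (heavyIndexSets (l + 1) (((l + 1 : ℕ) : ℝ) * t) u).card} with hH
  have hHle : sphereSample (k + 1) (m + 1) H ≤ ENNReal.ofReal (ε k) := by
    refine (sphereSample_many_heavy_le hk ht1).trans (ENNReal.ofReal_le_ofReal ?_)
    calc _ ≤ 2 * Real.exp (((k + 1 : ℕ) : ℝ) * R) ^ l * (Real.exp ((t - 1) / 2) *
        Real.exp (-(((k + 1 : ℕ) : ℝ) / 2 * (t - 1 - Real.log t)))) := by gcongr
      _ = 2 * Real.exp ((t - 1) / 2) * (Real.exp (l * (((k + 1 : ℕ) : ℝ) * R)) *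
        Real.exp (-(((k + 1 : ℕ) : ℝ) / 2 * (t - 1 - Real.log t)))) := by
          rw [← Real.exp_nat_mul]; ring
      _ = ε k := by
          rw [← Real.exp_add, hε, hδ]
          congr 2
          ring
  -- Subadditivity suffices here, so measurability of `H` is not needed.
  have hcompl : 1 - sphereSample (k + 1) (m + 1) H ≤ sphereSample (k + 1) (m + 1) Hᶜ := by
    rw [tsub_le_iff_left]
    calc (1 : ℝ≥0∞) = sphereSample (k + 1) (m + 1) (H ∪ Hᶜ) := by simp
      _ ≤ _ := measure_union_le _ _
  refine (tsub_le_tsub_left hHle 1).trans (hcompl.trans (measure_mono_ae ?_))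
  filter_upwards [ae_injective_sphereSample hk] with u hinj hu
  have hu' : ((heavyIndexSets (l + 1) (((l + 1 : ℕ) : ℝ) * t) u).card : ℝ) ≤
    ((m + 1 : ℕ) : ℝ) / 2 := not_lt.1 hu
  exact fun C' hC' => ⟨isAvgRadListDecodable_of_isExpurgation (Set.finite_range _)
    (sphericalCode_subset_closedBall P u) hC',
    half_le_ncard_of_isExpurgation k.succ_pos hP l.succ_pos hinj hu' hC'⟩

end MultiplePacking

theorem mainTheorem9 (P N : ℝ) (L : ℕ) (hP : 0 < P) (hN : 0 < N) (hL : 2 ≤ L)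
    (hNP : N / P ≤ ((L : ℝ) - 1) / L) :
    -- the lower bound on the capacity
    (((1 / 2 : ℝ) * (1 - L * N / (((L : ℝ) - 1) * P)
        - 1 / ((L : ℝ) - 1) * Real.log (L * (P - N) / P)) : ℝ) : EReal)
      ≤ MultiplePacking.avgRadCapacity P N L ∧
    -- every smaller rate is achieved, with probability tending to one, by expurgated random
    -- spherical codes
    ∀ R : ℝ, R < (1 / 2 : ℝ) * (1 - L * N / (((L : ℝ) - 1) * P)
        - 1 / ((L : ℝ) - 1) * Real.log (L * (P - N) / P)) →
      Tendsto (fun n : ℕ =>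
        MultiplePacking.sphereSample n ⌈Real.exp (n * R)⌉₊
          {u | ∀ C' : Set (MultiplePacking.Pt n),
            MultiplePacking.IsExpurgation N L (MultiplePacking.sphericalCode P u) C' →
              MultiplePacking.IsAvgRadListDecodable P N L C' ∧
              (⌈Real.exp (n * R)⌉₊ : ℝ) / 2 ≤ (C'.ncard : ℝ)})
        atTop (𝓝 1) := by
  refine ⟨?_, fun R hR => MultiplePacking.tendsto_sphereSample_expurgation hP hL hNP hR⟩
  refine EReal.ge_of_forall_gt_iff_ge.1 fun R hR => ?_
  rw [EReal.coe_lt_coe_iff] at hR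
  -- The gap between `R` and `R'` absorbs the rate loss `log 2 / n` from halving the code.
  obtain ⟨R', hRR', hR'⟩ := exists_between hR
  have hlog : Tendsto (fun n : ℕ => R' - Real.log 2 / n) atTop (𝓝 R') := by
    simpa using tendsto_const_nhds.sub
      (tendsto_const_nhds.div_atTop (tendsto_natCast_atTop_atTop (R := ℝ)))
  have hev := (MultiplePacking.tendsto_sphereSample_expurgation hP hL hNP hR').eventually_const_lt
    zero_lt_one
  refine le_limsup_of_frequently_le (Eventually.frequently ?_) (by isBoundedDefault)
  filter_upwards [hev, hlog.eventually_const_lt hRR', eventually_ge_atTop 1] with n hn hRn hn1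
  obtain ⟨u, hu⟩ := nonempty_of_measure_ne_zero hn.ne'
  obtain ⟨C', hC'⟩ := MultiplePacking.exists_isExpurgation N (by omega : 0 < L)
    (MultiplePacking.sphericalCode P u)
  obtain ⟨hdec, hhalf⟩ := hu C' hC'
  have hfin : C'.Finite := by
    obtain ⟨c, -, rfl⟩ := hC'
    exact (Set.finite_range _).subset Set.sdiff_subset
  calc (R : EReal) ≤ ((R' - Real.log 2 / n : ℝ) : EReal) := EReal.coe_le_coe_iff.2 hRn.le
    _ ≤ MultiplePacking.rate C' :=
      MultiplePacking.le_rate_of_half_le_ncard (by omega) hfin (Nat.le_ceil _) hhalf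
    _ ≤ _ := le_iSup₂ (f := fun C (_ : C ∈ {C : Set (MultiplePacking.Pt n) |
        MultiplePacking.IsAvgRadListDecodable P N L C}) => MultiplePacking.rate C) C' hdec
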